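/- **Setting.** Let $\mathcal X$ be a measurable space, $\mathcal Y=\{0,1\}$, and let $\mathcal D$ be a probability distribution on $\mathcal X\times\mathcal Y$. Groups and models are functions $\mathcal X\to\{0,1\}$. Write $\mu_{\mathcal D}(g)=\Pr_{\mathcal D}[g(x)=1]$ and $L(\mathcal D,f,g)=\Pr_{(x,y)\sim\mathcal D}[f(x)\ne y\mid g(x)=1]$; for a finite dataset $S$, $\mu_S(g)$ and $L(S,f,g)$ are the same quantities for the uniform distribution on the elements of $S$. A model $f$ is $(\epsilon,\mathcal C)$-Bayes optimal for a set $\mathcal C$ of pairs $(g,h)$ if $L(\mathcal D,f,g)\le L(\mathcal D,h,g)+\epsilon/\mu_{\mathcal D}(g)$ for every $(g,h)\in\mathcal C$ with $\mu_{\mathcal D}(g)>0$. An *exact optimizer* over $\mathcal C$ is a sub-routine that, given any model $f$ and dataset $S$, returns a pair $(g,h)\in\mathcal C$ that maximizes $\mu_S(g)\,(L(S,f,g)-L(S,h,g))$ over $\mathcal C$ (with ties broken in any way; the objective is $0$ when $\mu_S(g)=0$). **Algorithm** TrainByOpt$(D,\mathcal C,\epsilon)$, with an arbitrary fixed measurable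 initial model $f_0$. Let $T=\lfloor 2/\epsilon\rfloor$ and divide $D$ uniformly at random (independently of the sample) into $T$ datasets $D_1,\dots,D_T$ of size $\lfloor n/T\rfloor$ each, leaving the remaining fewer than $T$ examples unused. For $t=1,\dots,T$: call the optimizer on $(f_{t-1},D_t)$ to obtain $(g_t,h_t)$; if $\mu_{D_t}(g_t)(L(D_t,f_{t-1},g_t)-L(D_t,h_t,g_t))\le 3\epsilon/4$, stop and output $f_{t-1}$; otherwise let $f_t(x)=h_t(x)$ if $g_t(x)=1$ and $f_t(x)=f_{t-1}(x)$ if $g_t(x)=0$. If no round stops, output $f_T$. **Measurability conventions.** (i) For all $(g,h)\in\mathcal C$, $g$ and $h$ are measurable. (ii) For all $k$ and all $a,b\in\{0,1\}^k$, the set of samples $((x_i,y_i))_{i\le k}$ for which some $(g,h)\in\mathcal C$ satisfies $g(x_i)=a_i$ and $h(x_i)=b_i$ for all $i\le k$ is measurable up to a $\mathcal D^k$-null set (automatic given (i) if $\mathcal C$ is countable). (iii) The optimizer is measurable: whenever $F_D$ is a model depending on a dataset $D$ of some fixed size such that $(D,x)\mapsto F_D(x)$ is measurable, the pair $(g,h)$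 returned on input $(F_D,S)$, with $S$ of some fixed size, is such that $g(x)$ and $h(x)$ are measurable functions of $(D,S,x)$. **Theorem.** There are absolute constants $K>0$ and $q\in\mathbb N$ such that the following holds for every such $\mathcal X$ and $\mathcal D$. Let $\mathcal G$ be a class of groups of VC dimension $d_G<\infty$ and $\mathcal H$ a class of models of VC dimension $d_H<\infty$, let $\mathcal C\subseteq\mathcal G\times\mathcal H$, $\epsilon>0$ and $0<\delta<1$, and suppose that an exact optimizer over $\mathcal C$ is given, under the conventions above. If $$n\;\ge\;K\,A\,\log(2+A)^q,\qquad A=\frac{d_G+d_H+\log(2/\delta)}{\epsilon^3},$$ that is, $n\ge\tilde O\big((d_G+d_H+\log(1/\delta))/\epsilon^3\big)$, and $D\sim\mathcal D^n$, then with probability at least $1-\delta$ over $D$ and the random division (the failure event has outer measure at most $\delta$), TrainByOpt$(D,\mathcal C,\epsilon)$ returns an $(\epsilon,\mathcal C)$-Bayes optimal model. On every input it makes at most $2/\epsilon$ calls to the optimizer. -/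

import Mathlib

open MeasureTheory ProbabilityTheory

universe u

namespace BiasBounty

/-- Binary functions on the feature space. They serve both as group indicator functions
(`g x = true` means that `x` belongs to the group) and as binary models. -/
abbrev BinFun (X : Type u) := X → Bool

/-- A dataset of `n` labelled examples. -/
abbrev Dataset (X : Type u) (n : ℕ) := Fin n → X × Bool

section VC

variable {X : Type u}

/-- The class `F` shatters the finite set `s`: each labelling of `s` is realized by a member. -/
def Shatters (F : Set (BinFun X)) (s : Finset X) : Prop :=
  ∀ b : X → Bool, ∃ f ∈ F, ∀ x ∈ s, f x = b x

/-- The VC dimension: the supremum of the cardinalities of the shattered finite sets. -/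
noncomputable def vcDim (F : Set (BinFun X)) : ℕ∞ :=
  ⨆ (s : Finset X) (_ : Shatters F s), (s.card : ℕ∞)

end VC

section Population

variable {X : Type u} [MeasurableSpace X]

/-- The classification loss `1[ŷ ≠ y]`. -/
def zeroOneLoss (yhat y : Bool) : ℝ := if yhat ≠ y then 1 else 0

/-- The mass of the group `g` under the distribution `P`. -/
noncomputable def groupMass (P : Measure (X × Bool)) (g : BinFun X) : ℝ :=
  P.real {z | g z.1 = true}

/-- The loss of `f` on the group `g`: the expectation of the classification loss of `f`
under `P` conditioned on membership in `g`. -/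
noncomputable def groupLoss (P : Measure (X × Bool)) (f g : BinFun X) : ℝ :=
  ∫ z, zeroOneLoss (f z.1) z.2 ∂(P[|{z | g z.1 = true}])

/-- `f` is `(ε, C)`-Bayes optimal. Groups of mass zero impose no condition, since there
the conditional loss is undefined and the slack `ε / 0` is infinite. -/
def IsBayesOptimal (P : Measure (X × Bool)) (ε : ℝ) (C : Set (BinFun X × BinFun X))
    (f : BinFun X) : Prop :=
  ∀ c ∈ C, 0 < groupMass P c.1 →
    groupLoss P f c.1 ≤ groupLoss P c.2 c.1 + ε / groupMass P c.1

end Population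

section Empirical

variable {X : Type u}

/-- The fraction of the examples of `S` that belong to the group `g`. -/
noncomputable def empMass {m : ℕ} (S : Dataset X m) (g : BinFun X) : ℝ :=
  ((Finset.univ.filter fun i => g (S i).1 = true).card : ℝ) / m

/-- The average loss of `f` over the examples of `S` that belong to the group `g`
(zero if there are none; it is only used multiplied by `empMass S g`). -/
noncomputable def empLoss {m : ℕ} (S : Dataset X m) (f g : BinFun X) : ℝ :=
  (∑ i ∈ Finset.univ.filter (fun i => g (S i).1 = true), zeroOneLoss (f (S i).1) (S i).2) /
    ((Finset.univ.filter fun i => g (S i).1 = true).card : ℝ)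

/-- The objective `μ_S(g) * (L(S, f, g) - L(S, h, g))` at the pair `c = (g, h)`. -/
noncomputable def objective {m : ℕ} (S : Dataset X m) (f : BinFun X)
    (c : BinFun X × BinFun X) : ℝ :=
  empMass S c.1 * (empLoss S f c.1 - empLoss S c.2 c.1)

/-- A sub-routine that receives a model and a dataset (of any size) and returns a pair. -/
abbrev Optimizer (X : Type u) := ∀ m : ℕ, BinFun X → Dataset X m → BinFun X × BinFun X

/-- The sub-routine solves the optimization problem over `C` exactly: on each input it
returns a maximizer of the objective over `C`. Ties may be broken in any way. -/
def IsExactOptimizer (C : Set (BinFun X × BinFun X)) (opt : Optimizer X) : Prop :=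
  ∀ (m : ℕ) (f : BinFun X) (S : Dataset X m),
    opt m f S ∈ C ∧ ∀ c ∈ C, objective S f c ≤ objective S f (opt m f S)

end Empirical

section Measurability

variable {X : Type u} [MeasurableSpace X]

/-- The sub-routine is measurable: if the input model has been computed from `k` examples `D`
in such a way that `(D, x) ↦ F D x` is measurable, then the values at `x` of the group and of
the model that are returned on input `(F D, S)` are measurable functions of `(D, S, x)`. -/
def IsMeasurableOptimizer (opt : Optimizer X) : Prop :=
  ∀ (k m : ℕ) (F : Dataset X k → BinFun X),
    Measurable (fun p : Dataset X k × X => F p.1 p.2) →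
      Measurable (fun p : (Dataset X k × Dataset X m) × X => (opt m (F p.1.1) p.1.2).1 p.2) ∧
      Measurable (fun p : (Dataset X k × Dataset X m) × X => (opt m (F p.1.1) p.1.2).2 p.2)

/-- The usual kind of measurability proviso of uniform convergence: for each pattern of values
`(a, b)`, the set of the samples on which some pair in `C` takes these values is measurable,
up to null sets. It holds for example whenever `C` is countable. -/
def IsTraceMeasurable (P : Measure (X × Bool)) (C : Set (BinFun X × BinFun X)) : Prop :=
  ∀ (k : ℕ) (a b : Fin k → Bool),
    NullMeasurableSet {S : Dataset X k | ∃ c ∈ C, ∀ i, c.1 (S i).1 = a i ∧ c.2 (S i).1 = b i}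
      (Measure.pi fun _ : Fin k => P)

end Measurability

section Algorithm

variable {X : Type u}

/-- The update of `f` by the pair `c = (g, h)`: predict with `h` on `g` and with `f` elsewhere. -/
def listUpdate (f : BinFun X) (c : BinFun X × BinFun X) : BinFun X :=
  fun x => if c.1 x = true then c.2 x else f x

open Classical in
/-- The main loop, run on the list of the batches that are still to be processed, with current
model `f`. It returns the output model together with the number of calls to `opt`. -/
noncomputable def trainLoop (opt : Optimizer X) (ε : ℝ) {m : ℕ} :
    List (Dataset X m) → BinFun X → BinFun X × ℕ
  | [], f => (f, 0)
  | S :: rest, f =>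
    if objective S f (opt m f S) ≤ 3 * ε / 4 then (f, 1)
    else
      let r := trainLoop opt ε rest (listUpdate f (opt m f S))
      (r.1, r.2 + 1)

/-- The number of rounds, `2 / ε` rounded down. -/
noncomputable def rounds (ε : ℝ) : ℕ := ⌊2 / ε⌋₊

/-- The `t`-th of the `T` batches of size `⌊n / T⌋` into which the dataset `D` is divided: it is
the `t`-th block of consecutive examples after `D` has been permuted by `σ`. If `T` does not
divide `n`, then the fewer than `T` examples at the end are not used. -/
def batch {n : ℕ} (T : ℕ) (D : Dataset X n) (σ : Equiv.Perm (Fin n)) (t : Fin T) :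
    Dataset X (n / T) :=
  fun j => D (σ ⟨t * (n / T) + j, by
    have h1 : (t : ℕ) * (n / T) + j < (t + 1) * (n / T) := by
      have := j.isLt
      rw [add_mul, one_mul]
      omega
    exact h1.trans_le ((Nat.mul_le_mul_right _ t.isLt).trans (Nat.mul_div_le n T))⟩)

/-- `TrainByOpt`, with optimization sub-routine `opt`, initial model `f₀` and random division `σ`.
It returns the trained model and the number of calls to `opt`. -/
noncomputable def trainByOpt (opt : Optimizer X) (ε : ℝ) (f₀ : BinFun X) {n : ℕ}
    (D : Dataset X n) (σ : Equiv.Perm (Fin n)) : BinFun X × ℕ :=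
  trainLoop opt ε (List.ofFn fun t : Fin (rounds ε) => batch (rounds ε) D σ t) f₀

end Algorithm

instance permMeasurableSpace (n : ℕ) : MeasurableSpace (Equiv.Perm (Fin n)) := ⊤

/-- The joint law of an i.i.d. dataset `D` of size `n` and of an independent, uniformly random
permutation of the indices. -/
noncomputable def runLaw {X : Type u} [MeasurableSpace X] (P : Measure (X × Bool)) (n : ℕ) :
    Measure (Dataset X n × Equiv.Perm (Fin n)) :=
  (Measure.pi fun _ : Fin n => P).prod (uniformOn Set.univ)

end BiasBounty

/-! The objective is the empirical mean of the `gain`, the drop of the loss on one example when f is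
updated by c = (g, h). The expectation `popGain` equals μ(g) (L(f, g) - L(h, g)) when μ(g) > 0, and
it is also the exact drop of the overall loss `popLoss` under the update. Hence a bound `popGain ≤
ε` over C yields Bayes optimality, and `popLoss`, with values in [0, 1], serves as a potential.

Suppose that in every round the empirical and expected gains differ by at most ε/4, uniformly over
C. If a round stops, no gain over C exceeds 3ε/4 + ε/4 = ε. A round that does not stop lowers the
potential by more than ε/2; after T = ⌊2/ε⌋ such rounds less than ε/2 is left, so again no gain can
exceed ε (`isBayesOptimal_trainLoop`).

The accuracy is a VC bound (`measure_exists_deviation_le`). The current model depends only on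
earlier batches, so it is independent of the fresh batch and may be treated as fixed; only the
complexity of C matters. A ghost batch, random exchanges between the two batches, Hoeffding's bound
for signs and the Sauer–Shelah count of patterns control a single round. A union bound over the
rounds and `sampleSize_bounds` finish the proof. All of this holds for each fixed permutation of the
sample, so the randomness of the division plays no role. -/

namespace BiasBounty

/-! ### Growth function of C via Sauer–Shelah. -/

section Growth

variable {X : Type u}

open Classical in
/-- The labellings of the points `x i` that are realized by members of `F`. -/
noncomputable def traces {ι : Type*} [Fintype ι] [DecidableEq ι] (F : Set (BinFun X)) (x : ι → X) :
    Finset (ι → Bool) :=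
  Finset.univ.filter fun a => ∃ g ∈ F, ∀ i, g (x i) = a i

lemma card_le_vcDim_of_shatters {F : Set (BinFun X)} {s : Finset X} {d : ℕ}
    (hd : vcDim F = d) (hs : Shatters F s) : s.card ≤ d := by
  have h : (s.card : ℕ∞) ≤ vcDim F :=
    le_iSup₂_of_le (f := fun (s : Finset X) (_ : Shatters F s) => (s.card : ℕ∞)) s hs le_rfl
  rw [hd] at h
  exact_mod_cast h

/-- Termwise comparison with the binomial expansion of (k + 1)^d, using C(k, i) ≤ k^i. -/
lemma sum_choose_le_pow (k d : ℕ) : ∑ i ∈ Finset.Iic d, k.choose i ≤ (k + 1) ^ d := by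
  have hI : Finset.Iic d = Finset.range (d + 1) := by
    ext i; simp
  rw [hI, add_pow]
  refine Finset.sum_le_sum fun i hi => ?_
  have hi' : i ≤ d := Nat.lt_succ_iff.mp (Finset.mem_range.mp hi)
  simp only [one_pow, mul_one, Nat.cast_id]
  exact (Nat.choose_le_pow k i).trans
    (Nat.le_mul_of_pos_right _ (Nat.choose_pos hi'))

/-- **Sauer–Shelah**, for labellings of a family of points that may have repetitions. -/
lemma card_traces_le {ι : Type*} [Fintype ι] [DecidableEq ι] {F : Set (BinFun X)} {d : ℕ}
    (hd : vcDim F = d) (x : ι → X) : (traces F x).card ≤ (Fintype.card ι + 1) ^ d := by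
  classical
  let toSet : (ι → Bool) → Finset ι := fun a => Finset.univ.filter fun i => a i = true
  have hinj : Function.Injective toSet := by
    intro a b hab
    funext i
    have := Finset.ext_iff.mp hab i
    simp only [toSet, Finset.mem_filter, Finset.mem_univ, true_and] at this
    exact Bool.eq_iff_iff.mpr this
  let A : Finset (Finset ι) := (traces F x).image toSet
  have hA : ∀ {u}, u ∈ A → ∃ g ∈ F, ∀ i, i ∈ u ↔ g (x i) = true := by
    intro u hu
    obtain ⟨a, ha, rfl⟩ := Finset.mem_image.mp hu
    obtain ⟨g, hg, hga⟩ := (Finset.mem_filter.mp ha).2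
    exact ⟨g, hg, fun i => by simp [toSet, hga]⟩
  have hvc : A.vcDim ≤ d := by
    refine Finset.sup_le fun s hs => ?_
    rw [Finset.mem_shatterer] at hs
    -- If x i = x j, every trace contains both indices or neither, so {i} could not be cut out of s.
    -- Hence shattered index sets correspond to genuine point sets of the same size.
    have hxinj : Set.InjOn x s := by
      intro i hi j hj hij
      by_contra hne
      obtain ⟨u, hu, hsu⟩ := hs (Finset.singleton_subset_iff.mpr hi)
      obtain ⟨g, -, hg⟩ := hA hu
      have h1 : i ∈ u := (Finset.mem_inter.mp (hsu ▸ Finset.mem_singleton_self i)).2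
      have h2 : j ∈ s ∩ u := Finset.mem_inter.mpr ⟨hj, (hg j).mpr (hij ▸ (hg i).mp h1)⟩
      rw [hsu, Finset.mem_singleton] at h2
      exact hne h2.symm
    rw [← Finset.card_image_of_injOn hxinj]
    refine card_le_vcDim_of_shatters hd fun b => ?_
    obtain ⟨u, hu, hsu⟩ := hs (Finset.filter_subset (fun i => b (x i) = true) s)
    obtain ⟨g, hgF, hg⟩ := hA hu
    refine ⟨g, hgF, fun y hy => ?_⟩
    obtain ⟨i, hi, rfl⟩ := Finset.mem_image.mp hy
    have := Finset.ext_iff.mp hsu i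
    simp only [Finset.mem_inter, Finset.mem_filter, hi, true_and] at this
    exact Bool.eq_iff_iff.mpr ((hg i).symm.trans this)
  calc (traces F x).card = A.card := (Finset.card_image_of_injective _ hinj).symm
    _ ≤ A.shatterer.card := A.card_le_card_shatterer
    _ ≤ ∑ i ∈ Finset.Iic A.vcDim, (Fintype.card ι).choose i :=
        Finset.card_shatterer_le_sum_vcDim
    _ ≤ (Fintype.card ι + 1) ^ A.vcDim := sum_choose_le_pow _ _
    _ ≤ (Fintype.card ι + 1) ^ d := Nat.pow_le_pow_right (Nat.succ_pos _) hvc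

open Classical in
/-- The pairs of labellings of the points `x i` that are realized by members of `C`. -/
noncomputable def pairTraces {ι : Type*} [Fintype ι] [DecidableEq ι] (C : Set (BinFun X × BinFun X))
    (x : ι → X) : Finset ((ι → Bool) × (ι → Bool)) :=
  Finset.univ.filter fun p => ∃ c ∈ C, ∀ i, c.1 (x i) = p.1 i ∧ c.2 (x i) = p.2 i

lemma card_pairTraces_le {ι : Type*} [Fintype ι] [DecidableEq ι] {G H : Set (BinFun X)}
    {C : Set (BinFun X × BinFun X)} {dG dH : ℕ} (hG : vcDim G = dG) (hH : vcDim H = dH)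
    (hC : C ⊆ G ×ˢ H) (x : ι → X) :
    (pairTraces C x).card ≤ (Fintype.card ι + 1) ^ (dG + dH) := by
  classical
  have hsub : pairTraces C x ⊆ traces G x ×ˢ traces H x := by
    intro p hp
    obtain ⟨c, hc, hcp⟩ := (Finset.mem_filter.mp hp).2
    refine Finset.mem_product.mpr ⟨?_, ?_⟩
    · exact Finset.mem_filter.mpr ⟨Finset.mem_univ _, c.1, (hC hc).1, fun i => (hcp i).1⟩
    · exact Finset.mem_filter.mpr ⟨Finset.mem_univ _, c.2, (hC hc).2, fun i => (hcp i).2⟩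
  calc (pairTraces C x).card ≤ (traces G x ×ˢ traces H x).card := Finset.card_le_card hsub
    _ = (traces G x).card * (traces H x).card := Finset.card_product _ _
    _ ≤ _ := by
      rw [pow_add]
      exact Nat.mul_le_mul (card_traces_le hG x) (card_traces_le hH x)

end Growth

/-! ### Hoeffding's inequality for random signs. -/

section Rademacher

/-- The sign `±1` encoded by a Boolean. -/
def boolSign (b : Bool) : ℝ := if b then -1 else 1

/-- The exponential sum factorizes over the coordinates into terms 2 cosh(l v i), and cosh x ≤
exp(x²/2). -/
lemma sum_exp_boolSign_le {ι : Type*} [Fintype ι] [DecidableEq ι] (v : ι → ℝ) {r : ℝ}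
    (hv : ∀ i, |v i| ≤ r) (l : ℝ) :
    ∑ σ : ι → Bool, Real.exp (l * ∑ i, boolSign (σ i) * v i) ≤
      2 ^ Fintype.card ι * Real.exp (Fintype.card ι * (l ^ 2 * r ^ 2 / 2)) := by
  have h1 : ∀ σ : ι → Bool, Real.exp (l * ∑ i, boolSign (σ i) * v i) =
      ∏ i, Real.exp (l * (boolSign (σ i) * v i)) := fun σ => by
    rw [Finset.mul_sum, Real.exp_sum]
  simp_rw [h1]
  rw [← Fintype.piFinset_univ,
    ← Finset.prod_univ_sum (fun _ => Finset.univ) fun i b => Real.exp (l * (boolSign b * v i))]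
  have h2 : ∀ i, ∑ b : Bool, Real.exp (l * (boolSign b * v i)) ≤
      2 * Real.exp (l ^ 2 * r ^ 2 / 2) := fun i => by
    have : ∑ b : Bool, Real.exp (l * (boolSign b * v i)) = 2 * Real.cosh (l * v i) := by
      rw [Real.cosh_eq, Fintype.sum_bool]
      simp only [boolSign, if_true, Bool.false_eq_true, if_false]
      ring_nf
    rw [this]
    refine mul_le_mul_of_nonneg_left ((Real.cosh_le_exp_half_sq _).trans ?_) zero_le_two
    have := sq_le_sq' (neg_le_of_abs_le (hv i)) (le_of_abs_le (hv i))
    rw [mul_pow]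
    gcongr
  calc ∏ i, ∑ b : Bool, Real.exp (l * (boolSign b * v i))
      ≤ ∏ _i : ι, (2 * Real.exp (l ^ 2 * r ^ 2 / 2)) :=
        Finset.prod_le_prod (fun i _ => Finset.sum_nonneg fun _ _ => (Real.exp_pos _).le)
          fun i _ => h2 i
    _ = _ := by
      rw [Finset.prod_const, Finset.card_univ, mul_pow, ← Real.exp_nat_mul]

/-- One-sided Hoeffding bound for signed sums, in counting form. -/
lemma card_lt_sum_boolSign_le {ι : Type*} [Fintype ι] [DecidableEq ι] (v : ι → ℝ)
    (hv : ∀ i, |v i| ≤ 2) (s : ℝ) (hs : 0 ≤ s) :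
    ((Finset.univ.filter fun σ : ι → Bool =>
        Fintype.card ι * s < ∑ i, boolSign (σ i) * v i).card : ℝ) ≤
      2 ^ Fintype.card ι * Real.exp (-(Fintype.card ι * s ^ 2 / 8)) := by
  -- The choice l = s/4 minimizes the Chernoff exponent 2l² - ls obtained for r = 2.
  have h := sum_exp_boolSign_le v hv (s / 4)
  set k : ℝ := (Fintype.card ι : ℝ)
  have h1 : ((Finset.univ.filter fun σ : ι → Bool =>
        k * s < ∑ i, boolSign (σ i) * v i).card : ℝ) * Real.exp (s / 4 * (k * s)) ≤
      ∑ σ : ι → Bool, Real.exp (s / 4 * ∑ i, boolSign (σ i) * v i) := by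
    rw [← nsmul_eq_mul]
    refine (Finset.card_nsmul_le_sum _ _ _ fun σ hσ => ?_).trans
      (Finset.sum_le_sum_of_subset_of_nonneg (Finset.filter_subset _ _)
        fun _ _ _ => (Real.exp_pos _).le)
    have := (Finset.mem_filter.mp hσ).2
    gcongr
  have h2 := h1.trans h
  rw [← le_div_iff₀ (Real.exp_pos _), mul_div_assoc, ← Real.exp_sub] at h2
  refine h2.trans_eq ?_
  rw [show k * ((s / 4) ^ 2 * 2 ^ 2 / 2) - s / 4 * (k * s) = -(k * s ^ 2 / 8) by ring]

lemma card_lt_abs_sum_boolSign_le {ι : Type*} [Fintype ι] [DecidableEq ι] (v : ι → ℝ)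
    (hv : ∀ i, |v i| ≤ 2) (s : ℝ) (hs : 0 ≤ s) :
    ((Finset.univ.filter fun σ : ι → Bool =>
        Fintype.card ι * s < |∑ i, boolSign (σ i) * v i|).card : ℝ) ≤
      2 * (2 ^ Fintype.card ι * Real.exp (-(Fintype.card ι * s ^ 2 / 8))) := by
  have h1 := card_lt_sum_boolSign_le v hv s hs
  have h2 := card_lt_sum_boolSign_le (fun i => -v i) (fun i => by simpa using hv i) s hs
  have hsub : (Finset.univ.filter fun σ : ι → Bool =>
        Fintype.card ι * s < |∑ i, boolSign (σ i) * v i|) ⊆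
      (Finset.univ.filter fun σ : ι → Bool =>
        Fintype.card ι * s < ∑ i, boolSign (σ i) * v i) ∪
      (Finset.univ.filter fun σ : ι → Bool =>
        Fintype.card ι * s < ∑ i, boolSign (σ i) * -v i) := by
    intro σ hσ
    simpa [lt_abs] using hσ
  have h3 := (Finset.card_le_card hsub).trans (Finset.card_union_le _ _)
  have h4 := (Nat.cast_le (α := ℝ)).mpr h3
  push_cast at h4
  linarith

end Rademacher

/-! ### Subsamples of an i.i.d. sample. -/

section Product

variable {Z : Type*} [MeasurableSpace Z]

/-- Selecting distinct coordinates of an i.i.d. sample yields an i.i.d. sample. -/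
lemma measurePreserving_comp_injective {ι κ : Type*} [Fintype ι] [Fintype κ]
    (μ : Measure Z) [IsProbabilityMeasure μ] {e : ι → κ} (he : Function.Injective e) :
    MeasurePreserving (fun (D : κ → Z) i => D (e i)) (Measure.pi fun _ => μ)
      (Measure.pi fun _ => μ) := by
  classical
  have hm : Measurable fun (D : κ → Z) i => D (e i) :=
    measurable_pi_lambda _ fun i => measurable_pi_apply _
  refine ⟨hm, (Measure.pi_eq fun s hs => ?_).symm⟩
  rw [Measure.map_apply hm (MeasurableSet.univ_pi hs)]
  -- The preimage of a box is a box whose sides outside the range of e are the whole space, and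
  -- these contribute factors 1.
  have : (fun (D : κ → Z) i => D (e i)) ⁻¹' Set.univ.pi s =
      Set.univ.pi fun k => if h : ∃ i, e i = k then s h.choose else Set.univ := by
    ext D
    simp only [Set.mem_preimage, Set.mem_univ_pi]
    constructor
    · intro h k
      split_ifs with hk
      · have := h hk.choose
        rwa [hk.choose_spec] at this
      · trivial
    · intro h i
      have := h (e i)
      have hk : ∃ j, e j = e i := ⟨i, rfl⟩
      rw [dif_pos hk, he hk.choose_spec] at this
      exact this
  rw [this, Measure.pi_pi]
  have h1 : ∀ k, k ∉ Finset.univ.image e →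
      μ (if h : ∃ i, e i = k then s h.choose else Set.univ) = 1 := by
    intro k hk
    rw [dif_neg (by simpa using hk), measure_univ]
  rw [← Finset.prod_subset (Finset.subset_univ (Finset.univ.image e)) fun k _ hk => h1 k hk,
    Finset.prod_image fun i _ j _ h => he h]
  refine Finset.prod_congr rfl fun i _ => ?_
  have hk : ∃ j, e j = e i := ⟨i, rfl⟩
  rw [dif_pos hk, he hk.choose_spec]

/-- Distinct coordinates of an i.i.d. sample, split into two independent samples. -/
lemma measurePreserving_comp_prod {ι ι' κ : Type*} [Fintype ι] [Fintype ι'] [Fintype κ]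
    (μ : Measure Z) [IsProbabilityMeasure μ] {e : ι → κ} {e' : ι' → κ}
    (he : Function.Injective (Sum.elim e e')) :
    MeasurePreserving (fun (D : κ → Z) => ((fun i => D (e i)), fun i => D (e' i)))
      (Measure.pi fun _ => μ) ((Measure.pi fun _ => μ).prod (Measure.pi fun _ => μ)) :=
  (measurePreserving_sumPiEquivProdPi (X := fun _ : ι ⊕ ι' => Z) fun _ => μ).comp
    (measurePreserving_comp_injective μ he)

lemma measurePreserving_sumElim {ι ι' : Type*} [Fintype ι] [Fintype ι']
    (μ : Measure Z) [IsProbabilityMeasure μ] :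
    MeasurePreserving (fun p : (ι → Z) × (ι' → Z) => (Sum.elim p.1 p.2 : ι ⊕ ι' → Z))
      ((Measure.pi fun _ => μ).prod (Measure.pi fun _ => μ)) (Measure.pi fun _ => μ) := by
  convert! measurePreserving_sumPiEquivProdPi_symm (X := fun _ : ι ⊕ ι' => Z) fun _ => μ using 1

end Product

end BiasBounty

namespace BiasBounty

/-! ### Gains, and the overall loss as a potential. -/

section Gain

variable {X : Type u}

lemma zeroOneLoss_nonneg (a b : Bool) : 0 ≤ zeroOneLoss a b := by
  unfold zeroOneLoss; split_ifs <;> norm_num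

lemma zeroOneLoss_le_one (a b : Bool) : zeroOneLoss a b ≤ 1 := by
  unfold zeroOneLoss; split_ifs <;> norm_num

/-- The decrease of the loss on an example with label `y` when the prediction `p` is replaced by
`b` provided that `a` holds. -/
noncomputable def labelGain (p y a b : Bool) : ℝ :=
  if a = true then zeroOneLoss p y - zeroOneLoss b y else 0

lemma abs_labelGain_le (p y a b : Bool) : |labelGain p y a b| ≤ 1 := by
  unfold labelGain zeroOneLoss
  cases p <;> cases y <;> cases a <;> cases b <;> norm_num

/-- The decrease of the loss of `f` on the example `z` upon the update by the pair `c`. -/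
noncomputable def gain (f : BinFun X) (c : BinFun X × BinFun X) (z : X × Bool) : ℝ :=
  labelGain (f z.1) z.2 (c.1 z.1) (c.2 z.1)

lemma abs_gain_le (f : BinFun X) (c : BinFun X × BinFun X) (z : X × Bool) : |gain f c z| ≤ 1 :=
  abs_labelGain_le _ _ _ _

lemma gain_eq_sub (f : BinFun X) (c : BinFun X × BinFun X) (z : X × Bool) :
    gain f c z = zeroOneLoss (f z.1) z.2 - zeroOneLoss (listUpdate f c z.1) z.2 := by
  unfold gain labelGain listUpdate
  split_ifs <;> simp

/-- The size of the group cancels between `empMass` and `empLoss`; an empty group gives 0 on both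
sides. This turns the objective into an average of bounded terms, as concentration requires. -/
lemma objective_eq {m : ℕ} (S : Dataset X m) (f : BinFun X) (c : BinFun X × BinFun X) :
    objective S f c = (∑ i, gain f c (S i)) / m := by
  have h : ∑ i, gain f c (S i) =
      (∑ i ∈ Finset.univ.filter (fun i => c.1 (S i).1 = true), zeroOneLoss (f (S i).1) (S i).2) -
      ∑ i ∈ Finset.univ.filter (fun i => c.1 (S i).1 = true),
        zeroOneLoss (c.2 (S i).1) (S i).2 := by
    rw [← Finset.sum_sub_distrib, Finset.sum_filter]
    rfl
  unfold objective empMass empLoss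
  rw [h, ← sub_div]
  by_cases h0 : (Finset.univ.filter fun i => c.1 (S i).1 = true).card = 0
  · simp [Finset.card_eq_zero.mp h0]
  · have : ((Finset.univ.filter fun i => c.1 (S i).1 = true).card : ℝ) ≠ 0 := by exact_mod_cast h0
    rw [div_mul_div_comm, mul_comm (m : ℝ), mul_div_mul_left _ _ this]

variable [MeasurableSpace X]

/-- The expected gain under the distribution `P`. -/
noncomputable def popGain (P : Measure (X × Bool)) (f : BinFun X) (c : BinFun X × BinFun X) : ℝ :=
  ∫ z, gain f c z ∂P

lemma measurable_labelGain {Ω : Type*} [MeasurableSpace Ω] {p y a b : Ω → Bool}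
    (hp : Measurable p) (hy : Measurable y) (ha : Measurable a) (hb : Measurable b) :
    Measurable fun ω => labelGain (p ω) (y ω) (a ω) (b ω) :=
  (Measurable.of_discrete (f := fun q : Bool × Bool × Bool × Bool =>
    labelGain q.1 q.2.1 q.2.2.1 q.2.2.2)).comp (hp.prodMk (hy.prodMk (ha.prodMk hb)))

lemma measurable_gain {f : BinFun X} {c : BinFun X × BinFun X} (hf : Measurable f)
    (hc : Measurable c.1 ∧ Measurable c.2) : Measurable (gain f c) :=
  measurable_labelGain (hf.comp measurable_fst) measurable_snd (hc.1.comp measurable_fst)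
    (hc.2.comp measurable_fst)

lemma measurable_loss {f : BinFun X} (hf : Measurable f) :
    Measurable fun z : X × Bool => zeroOneLoss (f z.1) z.2 :=
  (Measurable.of_discrete (f := fun q : Bool × Bool => zeroOneLoss q.1 q.2)).comp
    ((hf.comp measurable_fst).prodMk measurable_snd)

lemma integrable_loss (P : Measure (X × Bool)) [IsFiniteMeasure P] {f : BinFun X}
    (hf : Measurable f) : Integrable (fun z : X × Bool => zeroOneLoss (f z.1) z.2) P :=
  Integrable.of_bound (measurable_loss hf).aestronglyMeasurable 1 <| .of_forall fun z => by
    rw [Real.norm_of_nonneg (zeroOneLoss_nonneg _ _)]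
    exact zeroOneLoss_le_one _ _

lemma measurable_listUpdate {f : BinFun X} {c : BinFun X × BinFun X} (hf : Measurable f)
    (hc : Measurable c.1 ∧ Measurable c.2) : Measurable (listUpdate f c) :=
  Measurable.ite (measurableSet_eq_fun hc.1 measurable_const) hc.2 hf

/-- The misclassification probability of `f`. -/
noncomputable def popLoss (P : Measure (X × Bool)) (f : BinFun X) : ℝ :=
  ∫ z, zeroOneLoss (f z.1) z.2 ∂P

lemma popLoss_nonneg (P : Measure (X × Bool)) (f : BinFun X) : 0 ≤ popLoss P f :=
  integral_nonneg fun _ => zeroOneLoss_nonneg _ _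

lemma popLoss_le_one (P : Measure (X × Bool)) [IsProbabilityMeasure P] (f : BinFun X) :
    popLoss P f ≤ 1 := by
  have := norm_integral_le_of_norm_le_const (μ := P)
    (f := fun z : X × Bool => zeroOneLoss (f z.1) z.2) (C := 1) <| .of_forall fun z => by
      rw [Real.norm_of_nonneg (zeroOneLoss_nonneg _ _)]
      exact zeroOneLoss_le_one _ _
  simp only [probReal_univ, mul_one] at this
  exact (le_abs_self _).trans this

/-- This identity makes the overall loss a potential: each accepted update is paid for by its
expected gain. -/
lemma popLoss_listUpdate (P : Measure (X × Bool)) [IsFiniteMeasure P] {f : BinFun X}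
    {c : BinFun X × BinFun X} (hf : Measurable f) (hc : Measurable c.1 ∧ Measurable c.2) :
    popLoss P (listUpdate f c) = popLoss P f - popGain P f c := by
  unfold popGain popLoss
  simp_rw [gain_eq_sub]
  rw [integral_sub (integrable_loss P hf) (integrable_loss P (measurable_listUpdate hf hc))]
  ring

lemma popGain_eq_groupLoss (P : Measure (X × Bool)) [IsProbabilityMeasure P] {f : BinFun X}
    {c : BinFun X × BinFun X} (hf : Measurable f) (hc : Measurable c.1 ∧ Measurable c.2)
    (h0 : 0 < groupMass P c.1) :
    popGain P f c = groupMass P c.1 * (groupLoss P f c.1 - groupLoss P c.2 c.1) := by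
  set A : Set (X × Bool) := {z | c.1 z.1 = true} with hA
  have hAm : MeasurableSet A :=
    measurableSet_eq_fun (hc.1.comp measurable_fst) measurable_const
  have hgl : ∀ h : BinFun X, groupLoss P h c.1 =
      (groupMass P c.1)⁻¹ * ∫ z in A, zeroOneLoss (h z.1) z.2 ∂P := fun h => by
    unfold groupLoss groupMass
    rw [← hA, ProbabilityTheory.cond, integral_smul_measure, ENNReal.toReal_inv, smul_eq_mul]
    rfl
  rw [hgl, hgl, ← mul_sub, mul_inv_cancel_left₀ h0.ne',
    ← integral_sub (integrable_loss P hf).integrableOn (integrable_loss P hc.2).integrableOn,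
    ← integral_indicator hAm]
  refine integral_congr_ae (.of_forall fun z => ?_)
  simp only [gain, labelGain, Set.indicator, hA, Set.mem_ofPred_eq]

lemma isBayesOptimal_of_popGain_le {P : Measure (X × Bool)} [IsProbabilityMeasure P] {ε : ℝ}
    {C : Set (BinFun X × BinFun X)} {f : BinFun X} (hf : Measurable f)
    (hC : ∀ c ∈ C, Measurable c.1 ∧ Measurable c.2) (h : ∀ c ∈ C, popGain P f c ≤ ε) :
    IsBayesOptimal P ε C f := by
  intro c hc h0
  have h1 := h c hc
  rw [popGain_eq_groupLoss P hf (hC c hc) h0, ← le_div_iff₀' h0] at h1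
  linarith

/-- An expected gain is a difference of two numbers in [0, 1], hence at most 1. -/
lemma isBayesOptimal_of_one_le (P : Measure (X × Bool)) [IsProbabilityMeasure P] {ε : ℝ}
    (hε : 1 ≤ ε) {C : Set (BinFun X × BinFun X)} {f : BinFun X} (hf : Measurable f)
    (hC : ∀ c ∈ C, Measurable c.1 ∧ Measurable c.2) : IsBayesOptimal P ε C f := by
  refine isBayesOptimal_of_popGain_le hf hC fun c hc => ?_
  have := popLoss_listUpdate P hf (hC c hc)
  linarith [popLoss_nonneg P (listUpdate f c), popLoss_le_one P f]

end Gain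

/-! ### Chebyshev bound for the ghost sample. -/

section Symmetrization

/-- The mean of `m` i.i.d. variables with values in `[-1, 1]` is within `s` of the expectation
with probability at least `1 / 2`, if `m * s ^ 2 ≥ 2`. -/
lemma half_le_measure_mean {Z : Type*} [MeasurableSpace Z] (P : Measure Z)
    [IsProbabilityMeasure P] {φ : Z → ℝ} (hφ : Measurable φ) (hb : ∀ z, |φ z| ≤ 1) {m : ℕ}
    {s : ℝ} (hs : 0 < s) (hm : 2 ≤ m * s ^ 2) :
    1 / 2 ≤ (Measure.pi fun _ : Fin m => P) {S | |(∑ i, φ (S i)) / m - ∫ z, φ z ∂P| ≤ s} := by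
  set μ := Measure.pi fun _ : Fin m => P
  have hm0 : (0 : ℝ) < m := by
    rcases Nat.eq_zero_or_pos m with h | h
    · subst h; norm_num at hm
    · exact_mod_cast h
  have hLp : MemLp φ 2 P := MemLp.of_bound hφ.aestronglyMeasurable 1 (.of_forall hb)
  have hφi : ∀ i, Measurable fun S : Fin m → Z => φ (S i) := fun i =>
    hφ.comp (measurable_pi_apply i)
  have hsum : Measurable fun S : Fin m → Z => ∑ i, φ (S i) :=
    Finset.measurable_sum _ fun i _ => hφi i
  have hLpi : ∀ i, MemLp (fun S : Fin m → Z => φ (S i)) 2 μ := fun i =>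
    MemLp.of_bound (hφi i).aestronglyMeasurable 1 (.of_forall fun S => hb _)
  have hLps : MemLp (fun S : Fin m → Z => ∑ i, φ (S i)) 2 μ := memLp_finsetSum _ fun i _ => hLpi i
  have hint : ∫ S, ∑ i, φ (S i) ∂μ = m * ∫ z, φ z ∂P := by
    rw [integral_finsetSum _ fun i _ => (hLpi i).integrable one_le_two]
    have : ∀ i : Fin m, ∫ S, φ (S i) ∂μ = ∫ z, φ z ∂P := fun i =>
      integral_comp_eval (μ := fun _ : Fin m => P) hφ.aestronglyMeasurable
    simp [this]
  have hvar : Var[fun S : Fin m → Z => ∑ i, φ (S i); μ] ≤ m := by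
    have h1 := variance_sum_pi (μ := fun _ : Fin m => P) (X := fun _ => φ) fun _ => hLp
    have h2 : (∑ i : Fin m, fun S : Fin m → Z => φ (S i)) = fun S => ∑ i, φ (S i) := by
      ext S; simp
    rw [h2] at h1
    rw [h1]
    have h3 : Var[φ; P] ≤ 1 := by
      refine (variance_le_expectation_sq hφ.aestronglyMeasurable).trans ?_
      have := norm_integral_le_of_norm_le_const (μ := P) (f := φ ^ 2) (C := 1) <|
        .of_forall fun z => by
          simpa using hb z
      simp only [probReal_univ, mul_one] at this
      exact (le_abs_self _).trans this
    simpa using Finset.sum_le_card_nsmul (Finset.univ : Finset (Fin m)) (fun _ => Var[φ; P]) 1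
      fun _ _ => h3
  -- The variance of the sum is at most m, so the failure probability is at most m / (m s)² = 1 / (m
  -- s²) ≤ 1/2.
  have hcheb := meas_ge_le_variance_div_sq hLps (c := m * s) (by positivity)
  have hA : MeasurableSet {S : Fin m → Z | |(∑ i, φ (S i)) / m - ∫ z, φ z ∂P| ≤ s} :=
    measurableSet_le ((hsum.div_const _).sub_const _).abs measurable_const
  have hcompl : μ {S : Fin m → Z | |(∑ i, φ (S i)) / m - ∫ z, φ z ∂P| ≤ s}ᶜ ≤ 1 / 2 := by
    refine (measure_mono fun S hS => ?_).trans (hcheb.trans ?_)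
    · simp only [Set.mem_compl_iff, Set.mem_ofPred_eq, not_le] at hS ⊢
      rw [hint]
      have : (∑ i, φ (S i)) - m * ∫ z, φ z ∂P = m * ((∑ i, φ (S i)) / m - ∫ z, φ z ∂P) := by
        field_simp
      rw [this, abs_mul, abs_of_pos hm0]
      gcongr
    · rw [show (1 / 2 : ENNReal) = ENNReal.ofReal (1 / 2) by
        rw [ENNReal.ofReal_div_of_pos two_pos]; simp]
      refine ENNReal.ofReal_le_ofReal ?_
      rw [div_le_div_iff₀ (by positivity) two_pos]
      nlinarith
  by_contra hlt
  rw [not_le] at hlt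
  have h1 := measure_add_measure_compl (μ := μ) hA
  rw [measure_univ] at h1
  have h2 := ENNReal.add_lt_add_of_lt_of_le (by finiteness) hlt hcompl
  rw [h1, ENNReal.add_halves] at h2
  exact lt_irrefl _ h2

end Symmetrization

end BiasBounty

namespace BiasBounty

/-! ### Symmetrization by swaps, and uniform convergence over C. -/

section Swap

variable {X : Type u} {m : ℕ}

/-- Exchange the two copies of each index `j` with `σ j = true`. -/
def swapIndex (σ : Fin m → Bool) : Fin m ⊕ Fin m → Fin m ⊕ Fin m :=
  Sum.elim (fun j => if σ j then .inr j else .inl j) fun j => if σ j then .inl j else .inr j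

lemma swapIndex_involutive (σ : Fin m → Bool) : Function.Involutive (swapIndex σ) := by
  rintro (j | j) <;> cases h : σ j <;> simp [swapIndex, h]

/-- The difference of the total gains on the two halves of the double sample `W`, for a pair of
functions with the values `p` on `W`. -/
noncomputable def halfDiff (f : BinFun X) (p : (Fin m ⊕ Fin m → Bool) × (Fin m ⊕ Fin m → Bool))
    (W : Fin m ⊕ Fin m → X × Bool) : ℝ :=
  ∑ j, (labelGain (f (W (.inl j)).1) (W (.inl j)).2 (p.1 (.inl j)) (p.2 (.inl j)) -
    labelGain (f (W (.inr j)).1) (W (.inr j)).2 (p.1 (.inr j)) (p.2 (.inr j)))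

/-- The double samples on which some member of `C` has the values `p`. -/
def traceSet (C : Set (BinFun X × BinFun X)) {ι : Type*} (p : (ι → Bool) × (ι → Bool)) :
    Set (ι → X × Bool) :=
  {W | ∃ c ∈ C, ∀ i, c.1 (W i).1 = p.1 i ∧ c.2 (W i).1 = p.2 i}

/-- Exchanging the copies of j flips the sign of the j-th summand, so random swaps produce a signed
sum with fixed coefficients. -/
lemma halfDiff_swap (f : BinFun X) (p : (Fin m ⊕ Fin m → Bool) × (Fin m ⊕ Fin m → Bool))
    (W : Fin m ⊕ Fin m → X × Bool) (σ : Fin m → Bool) :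
    halfDiff f (p.1 ∘ swapIndex σ, p.2 ∘ swapIndex σ) (W ∘ swapIndex σ) =
      ∑ j, boolSign (σ j) *
        (labelGain (f (W (.inl j)).1) (W (.inl j)).2 (p.1 (.inl j)) (p.2 (.inl j)) -
          labelGain (f (W (.inr j)).1) (W (.inr j)).2 (p.1 (.inr j)) (p.2 (.inr j))) := by
  refine Finset.sum_congr rfl fun j _ => ?_
  cases h : σ j <;> simp [swapIndex, h, boolSign]

/-- Swaps permute the points of W without changing them, so the patterns of C on a swapped sample
are swapped patterns on W. Their number is bounded independently of σ, and a union bound of the sign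
inequality over them applies. -/
lemma card_swap_le {G H : Set (BinFun X)} {C : Set (BinFun X × BinFun X)} {dG dH : ℕ}
    (hG : vcDim G = dG) (hH : vcDim H = dH) (hC : C ⊆ G ×ˢ H) (f : BinFun X) {s : ℝ} (hs : 0 ≤ s)
    (W : Fin m ⊕ Fin m → X × Bool) [DecidablePred fun σ : Fin m → Bool =>
      ∃ p, W ∘ swapIndex σ ∈ traceSet C p ∧ m * s < |halfDiff f p (W ∘ swapIndex σ)|] :
    ((Finset.univ.filter fun σ : Fin m → Bool =>
      ∃ p, W ∘ swapIndex σ ∈ traceSet C p ∧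
        m * s < |halfDiff f p (W ∘ swapIndex σ)|).card : ℝ) ≤
      2 ^ m * (2 * (2 * m + 1) ^ (dG + dH) * Real.exp (-(m * s ^ 2 / 8))) := by
  classical
  let v : (Fin m ⊕ Fin m → Bool) × (Fin m ⊕ Fin m → Bool) → Fin m → ℝ := fun p j =>
    labelGain (f (W (.inl j)).1) (W (.inl j)).2 (p.1 (.inl j)) (p.2 (.inl j)) -
      labelGain (f (W (.inr j)).1) (W (.inr j)).2 (p.1 (.inr j)) (p.2 (.inr j))
  have hv : ∀ p j, |v p j| ≤ 2 := fun p j =>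
    (abs_sub _ _).trans (by
      linarith [abs_labelGain_le (f (W (.inl j)).1) (W (.inl j)).2 (p.1 (.inl j)) (p.2 (.inl j)),
        abs_labelGain_le (f (W (.inr j)).1) (W (.inr j)).2 (p.1 (.inr j)) (p.2 (.inr j))])
  have hsub : (Finset.univ.filter fun σ : Fin m → Bool =>
      ∃ p, W ∘ swapIndex σ ∈ traceSet C p ∧ m * s < |halfDiff f p (W ∘ swapIndex σ)|) ⊆
      (pairTraces C fun i => (W i).1).biUnion fun p => Finset.univ.filter fun σ : Fin m → Bool =>
        m * s < |∑ j, boolSign (σ j) * v p j| := by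
    intro σ hσ
    obtain ⟨p, ⟨c, hc, hcp⟩, hlt⟩ := (Finset.mem_filter.mp hσ).2
    refine Finset.mem_biUnion.mpr ⟨(fun i => c.1 (W i).1, fun i => c.2 (W i).1), ?_, ?_⟩
    · exact Finset.mem_filter.mpr ⟨Finset.mem_univ _, c, hc, fun i => ⟨rfl, rfl⟩⟩
    · refine Finset.mem_filter.mpr ⟨Finset.mem_univ _, ?_⟩
      rw [← halfDiff_swap f (fun i => c.1 (W i).1, fun i => c.2 (W i).1) W σ]
      convert hlt using 3
      exact Prod.ext (funext fun i => (hcp i).1) (funext fun i => (hcp i).2)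
  have h1 := (Finset.card_le_card hsub).trans Finset.card_biUnion_le
  have h2 : ∀ p ∈ pairTraces C fun i => (W i).1, ((Finset.univ.filter fun σ : Fin m → Bool =>
      m * s < |∑ j, boolSign (σ j) * v p j|).card : ℝ) ≤
      2 * (2 ^ m * Real.exp (-(m * s ^ 2 / 8))) := fun p _ => by
    have := card_lt_abs_sum_boolSign_le (v p) (hv p) s hs
    simpa only [Fintype.card_fin] using this
  have h3 := (Nat.cast_le (α := ℝ)).mpr h1
  rw [Nat.cast_sum] at h3
  have h4 := (Nat.cast_le (α := ℝ)).mpr (card_pairTraces_le hG hH hC fun i => (W i).1)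
  simp only [Fintype.card_sum, Fintype.card_fin] at h4
  push_cast at h4
  calc _ ≤ _ := h3
    _ ≤ _ := Finset.sum_le_card_nsmul _ _ _ h2
    _ ≤ (2 * m + 1) ^ (dG + dH) * (2 * (2 ^ m * Real.exp (-(m * s ^ 2 / 8)))) := by
      rw [nsmul_eq_mul, two_mul (m : ℝ)]
      gcongr
    _ = _ := by ring

variable [MeasurableSpace X]

lemma nullMeasurableSet_traceSet {P : Measure (X × Bool)} [IsProbabilityMeasure P]
    {C : Set (BinFun X × BinFun X)} (hC : IsTraceMeasurable P C)
    (p : (Fin m ⊕ Fin m → Bool) × (Fin m ⊕ Fin m → Bool)) :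
    NullMeasurableSet (traceSet C p) (Measure.pi fun _ => P) := by
  let e : Fin (m + m) → Fin m ⊕ Fin m := finSumFinEquiv.symm
  have h := (hC (m + m) (p.1 ∘ e) (p.2 ∘ e)).preimage
    (measurePreserving_comp_injective P
      (e := e) finSumFinEquiv.symm.injective).quasiMeasurePreserving
  convert h using 1
  ext W
  simp only [traceSet, Set.preimage_ofPred_eq, Set.mem_ofPred_eq, Function.comp_apply]
  refine exists_congr fun c => and_congr_right fun _ => ?_
  exact (finSumFinEquiv.symm.forall_congr_right (q := fun i =>
    c.1 (W i).1 = p.1 i ∧ c.2 (W i).1 = p.2 i)).symm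

lemma measurable_halfDiff {Ω : Type*} [MeasurableSpace Ω] {F : Ω → BinFun X}
    {W : Ω → Fin m ⊕ Fin m → X × Bool} (hW : ∀ i, Measurable fun ω => W ω i)
    (hF : ∀ i, Measurable fun ω => F ω (W ω i).1)
    (p : (Fin m ⊕ Fin m → Bool) × (Fin m ⊕ Fin m → Bool)) :
    Measurable fun ω => halfDiff (F ω) p (W ω) := by
  have h : ∀ i : Fin m ⊕ Fin m, Measurable fun ω =>
      labelGain (F ω (W ω i).1) (W ω i).2 (p.1 i) (p.2 i) := fun i =>
    measurable_labelGain (hF i) (hW i).snd measurable_const measurable_const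
  exact Finset.measurable_sum _ fun j _ => (h _).sub (h _)

/-- The i.i.d. law is invariant under every swap, so the probability equals its average over all 2^m
swaps; exchanging sum and integral reduces the claim to `card_swap_le` for each fixed W. -/
lemma measure_exists_halfDiff_le {P : Measure (X × Bool)} [IsProbabilityMeasure P]
    {G H : Set (BinFun X)} {C : Set (BinFun X × BinFun X)} {dG dH : ℕ}
    (hG : vcDim G = dG) (hH : vcDim H = dH) (hC : C ⊆ G ×ˢ H) (hCt : IsTraceMeasurable P C)
    {f : BinFun X} (hf : Measurable f) {s : ℝ} (hs : 0 ≤ s) :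
    (Measure.pi fun _ => P) {W : Fin m ⊕ Fin m → X × Bool |
      ∃ p, W ∈ traceSet C p ∧ m * s < |halfDiff f p W|} ≤
      ENNReal.ofReal (2 * (2 * m + 1) ^ (dG + dH) * Real.exp (-(m * s ^ 2 / 8))) := by
  classical
  set μ : Measure (Fin m ⊕ Fin m → X × Bool) := Measure.pi fun _ => P
  set q := 2 * (2 * (m : ℝ) + 1) ^ (dG + dH) * Real.exp (-(m * s ^ 2 / 8))
  set E := {W : Fin m ⊕ Fin m → X × Bool | ∃ p, W ∈ traceSet C p ∧ m * s < |halfDiff f p W|} with hE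
  have hEm : NullMeasurableSet E μ := by
    have : E = ⋃ p, traceSet C p ∩ {W | m * s < |halfDiff f p W|} := by
      ext W; simp [hE]
    rw [this]
    refine NullMeasurableSet.iUnion fun p => (nullMeasurableSet_traceSet hCt p).inter ?_
    exact (measurableSet_lt measurable_const
      (measurable_halfDiff (fun i => measurable_pi_apply i)
        (fun i => hf.comp (measurable_pi_apply i).fst) p).abs).nullMeasurableSet
  have hswap : ∀ σ : Fin m → Bool, MeasurePreserving
      (fun W : Fin m ⊕ Fin m → X × Bool => W ∘ swapIndex σ) μ μ := fun σ =>
    measurePreserving_comp_injective P (swapIndex_involutive σ).injective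
  have hpre : ∀ σ, NullMeasurableSet
      ((fun W : Fin m ⊕ Fin m → X × Bool => W ∘ swapIndex σ) ⁻¹' E) μ := fun σ =>
    hEm.preimage (hswap σ).quasiMeasurePreserving
  have hsum : (2 : ENNReal) ^ m * μ E ≤ 2 ^ m * ENNReal.ofReal q := by
    calc (2 : ENNReal) ^ m * μ E = ∑ σ : Fin m → Bool,
          μ ((fun W : Fin m ⊕ Fin m → X × Bool => W ∘ swapIndex σ) ⁻¹' E) := by
          simp_rw [fun σ => (hswap σ).measure_preimage hEm]
          simp
      _ = ∑ σ : Fin m → Bool, ∫⁻ W,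
          ((fun W : Fin m ⊕ Fin m → X × Bool => W ∘ swapIndex σ) ⁻¹' E).indicator
            (fun _ => (1 : ENNReal)) W ∂μ := by
          exact Finset.sum_congr rfl fun σ _ => (lintegral_indicator_one₀ (hpre σ)).symm
      _ = ∫⁻ W, ∑ σ : Fin m → Bool,
          ((fun W : Fin m ⊕ Fin m → X × Bool => W ∘ swapIndex σ) ⁻¹' E).indicator
            (fun _ => (1 : ENNReal)) W ∂μ :=
          (lintegral_finsetSum' _ fun σ _ => aemeasurable_const.indicator₀ (hpre σ)).symm
      _ ≤ ∫⁻ _, ENNReal.ofReal (2 ^ m * q) ∂μ := by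
          refine lintegral_mono fun W => ?_
          have h1 := card_swap_le hG hH hC f hs W
          have h2 : ∑ σ : Fin m → Bool,
              ((fun W : Fin m ⊕ Fin m → X × Bool => W ∘ swapIndex σ) ⁻¹' E).indicator
                (fun _ => (1 : ENNReal)) W =
              ((Finset.univ.filter fun σ : Fin m → Bool =>
                ∃ p, W ∘ swapIndex σ ∈ traceSet C p ∧
                  m * s < |halfDiff f p (W ∘ swapIndex σ)|).card : ENNReal) := by
            rw [Finset.card_filter]
            push_cast
            refine Finset.sum_congr rfl fun σ _ => ?_
            simp only [Set.indicator, hE, Set.mem_preimage, Set.mem_ofPred_eq]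
          rw [h2, ← ENNReal.ofReal_natCast]
          exact ENNReal.ofReal_le_ofReal h1
      _ = _ := by
          rw [lintegral_const, measure_univ, mul_one, ENNReal.ofReal_mul (by positivity),
            ENNReal.ofReal_pow zero_le_two, ENNReal.ofReal_ofNat]
  exact (ENNReal.mul_le_mul_iff_right (by positivity) (by finiteness)).mp hsum

/-- A measurable cover of the double samples with a large difference of the gains. -/
def coverSet (P : Measure (X × Bool)) (C : Set (BinFun X × BinFun X)) (s : ℝ) {Ω : Type*}
    (F : Ω → BinFun X) (m : ℕ) : Set (Ω × (Fin m ⊕ Fin m → X × Bool)) :=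
  {q | ∃ p, q.2 ∈ toMeasurable (Measure.pi fun _ => P) (traceSet C p) ∧
    m * s < |halfDiff (F q.1) p q.2|}

/-- Measurable hulls of the trace sets make the event jointly measurable in the parameter and the
sample, as needed for Fubini and Markov below. -/
lemma measurableSet_coverSet (P : Measure (X × Bool)) (C : Set (BinFun X × BinFun X)) (s : ℝ)
    {Ω : Type*} [MeasurableSpace Ω] {F : Ω → BinFun X}
    (hF : Measurable fun q : Ω × X => F q.1 q.2) : MeasurableSet (coverSet P C s F m) := by
  have : coverSet P C s F m = ⋃ p : (Fin m ⊕ Fin m → Bool) × (Fin m ⊕ Fin m → Bool),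
      (Prod.snd ⁻¹' toMeasurable (Measure.pi fun _ => P) (traceSet C p)) ∩
        {q | m * s < |halfDiff (F q.1) p q.2|} := by
    ext q; simp [coverSet]
  rw [this]
  have hi : ∀ i, Measurable fun q : Ω × (Fin m ⊕ Fin m → X × Bool) => q.2 i := fun i =>
    (measurable_pi_apply i).comp measurable_snd
  exact MeasurableSet.iUnion fun p =>
    (measurable_snd (measurableSet_toMeasurable _ _)).inter
      (measurableSet_lt measurable_const (measurable_halfDiff hi
        (fun i => hF.comp (measurable_fst.prodMk (hi i).fst)) p).abs)

/-- There are finitely many patterns, and each null-measurable trace set differs from its hull by a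
null set; so passing to the cover costs nothing. -/
lemma measure_coverSet_le {P : Measure (X × Bool)} [IsProbabilityMeasure P]
    {G H : Set (BinFun X)} {C : Set (BinFun X × BinFun X)} {dG dH : ℕ}
    (hG : vcDim G = dG) (hH : vcDim H = dH) (hC : C ⊆ G ×ˢ H) (hCt : IsTraceMeasurable P C)
    {Ω : Type*} {F : Ω → BinFun X} {ω : Ω} (hf : Measurable (F ω)) {s : ℝ} (hs : 0 ≤ s) :
    (Measure.pi fun _ => P) {W : Fin m ⊕ Fin m → X × Bool | (ω, W) ∈ coverSet P C s F m} ≤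
      ENNReal.ofReal (2 * (2 * m + 1) ^ (dG + dH) * Real.exp (-(m * s ^ 2 / 8))) := by
  refine (measure_mono_ae ?_).trans (measure_exists_halfDiff_le hG hH hC hCt hf hs)
  have h : ∀ᵐ W ∂(Measure.pi fun _ : Fin m ⊕ Fin m => P), ∀ p,
      W ∈ toMeasurable (Measure.pi fun _ => P) (traceSet C p) ↔ W ∈ traceSet C p :=
    ae_all_iff.mpr fun p => (nullMeasurableSet_traceSet hCt p).toMeasurable_ae_eq.mem_iff
  filter_upwards [h] with W hW hE
  obtain ⟨p, hp, hlt⟩ := hE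
  exact ⟨p, (hW p).mp hp, hlt⟩

/-- Uniform convergence of the gains over `C`, for a model that depends measurably on an
independent parameter. -/
lemma measure_exists_deviation_le {P : Measure (X × Bool)} [IsProbabilityMeasure P]
    {G H : Set (BinFun X)} {C : Set (BinFun X × BinFun X)} {dG dH : ℕ}
    (hG : vcDim G = dG) (hH : vcDim H = dH) (hC : C ⊆ G ×ˢ H)
    (hCm : ∀ c ∈ C, Measurable c.1 ∧ Measurable c.2) (hCt : IsTraceMeasurable P C)
    {Ω : Type*} [MeasurableSpace Ω] (ν : Measure Ω) [IsProbabilityMeasure ν] {F : Ω → BinFun X}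
    (hF : Measurable fun q : Ω × X => F q.1 q.2) {s : ℝ} (hs : 0 < s) (hm : 2 ≤ m * s ^ 2) :
    (ν.prod (Measure.pi fun _ => P)) {r : Ω × Dataset X m |
      ∃ c ∈ C, 2 * s < |objective r.2 (F r.1) c - popGain P (F r.1) c|} ≤
      2 * ENNReal.ofReal (2 * (2 * m + 1) ^ (dG + dH) * Real.exp (-(m * s ^ 2 / 8))) := by
  set μ : Measure (Dataset X m) := Measure.pi fun _ => P
  set q := 2 * (2 * (m : ℝ) + 1) ^ (dG + dH) * Real.exp (-(m * s ^ 2 / 8))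
  have hm0 : (0 : ℝ) < m := by
    rcases Nat.eq_zero_or_pos m with h | h
    · subst h; norm_num at hm
    · exact_mod_cast h
  have hFω : ∀ ω, Measurable (F ω) := fun ω => hF.comp measurable_prodMk_left
  let E : Set ((Ω × Dataset X m) × Dataset X m) :=
    {r | (r.1.1, Sum.elim r.1.2 r.2) ∈ coverSet P C s F m}
  have hEm : MeasurableSet E :=
    (measurable_fst.fst.prodMk ((measurePreserving_sumElim P).measurable.comp
      (measurable_fst.snd.prodMk measurable_snd))) (measurableSet_coverSet P C s hF)
  have hslice := measurable_measure_prodMk_left (ν := μ) hEm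
  have hsub : {r : Ω × Dataset X m |
      ∃ c ∈ C, 2 * s < |objective r.2 (F r.1) c - popGain P (F r.1) c|} ⊆
      {r | 1 / 2 ≤ μ (Prod.mk r ⁻¹' E)} := by
    rintro ⟨ω, S⟩ ⟨c, hc, hlt⟩
    -- If S deviates by more than 2s and the ghost sample S' by at most s, the two halves differ by
    -- more than s. So each bad (ω, S) has a slice of E of mass at least 1/2.
    have hhalf := half_le_measure_mean P (measurable_gain (hFω ω) (hCm c hc))
      (abs_gain_le (F ω) c) hs hm
    refine hhalf.trans (measure_mono fun S' hS' => ?_)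
    refine ⟨(fun i => c.1 ((Sum.elim S S' : _ → X × Bool) i).1,
      fun i => c.2 ((Sum.elim S S' : _ → X × Bool) i).1),
      subset_toMeasurable _ _ ⟨c, hc, fun i => ⟨rfl, rfl⟩⟩, ?_⟩
    have hd : halfDiff (F ω) (fun i => c.1 ((Sum.elim S S' : _ → X × Bool) i).1,
        fun i => c.2 ((Sum.elim S S' : _ → X × Bool) i).1) (Sum.elim S S') =
        m * ((∑ i, gain (F ω) c (S i)) / m - (∑ i, gain (F ω) c (S' i)) / m) := by
      rw [mul_sub, mul_div_cancel₀ _ hm0.ne', mul_div_cancel₀ _ hm0.ne', ← Finset.sum_sub_distrib]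
      rfl
    change _ < |halfDiff (F ω) _ (Sum.elim S S')|
    rw [hd, abs_mul, abs_of_pos hm0]
    refine mul_lt_mul_of_pos_left ?_ hm0
    simp only [objective_eq] at hlt
    have hS'' : |(∑ i, gain (F ω) c (S' i)) / m - popGain P (F ω) c| ≤ s := hS'
    have := abs_sub_abs_le_abs_sub ((∑ i, gain (F ω) c (S i)) / m - popGain P (F ω) c)
      ((∑ i, gain (F ω) c (S' i)) / m - popGain P (F ω) c)
    rw [sub_sub_sub_cancel_right] at this
    linarith
  have hint : ∫⁻ r, μ (Prod.mk r ⁻¹' E) ∂(ν.prod μ) ≤ ENNReal.ofReal q := by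
    rw [lintegral_prod _ hslice.aemeasurable]
    calc ∫⁻ ω, ∫⁻ S, μ (Prod.mk (ω, S) ⁻¹' E) ∂μ ∂ν ≤ ∫⁻ _, ENNReal.ofReal q ∂ν := by
          refine lintegral_mono fun ω => ?_
          have hW : MeasurableSet {W : Fin m ⊕ Fin m → X × Bool | (ω, W) ∈ coverSet P C s F m} :=
            measurable_prodMk_left (measurableSet_coverSet P C s hF)
          have h1 := (measurePreserving_sumElim (ι := Fin m) (ι' := Fin m) P).measure_preimage
            hW.nullMeasurableSet
          rw [Measure.prod_apply ((measurePreserving_sumElim P).measurable hW)] at h1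
          exact h1.trans_le (measure_coverSet_le hG hH hC hCt (hFω ω) hs.le)
      _ = _ := by simp
  -- Markov's inequality at level 1/2 is the source of the outer factor 2.
  have hmarkov := mul_meas_ge_le_lintegral (μ := ν.prod μ) hslice (1 / 2)
  calc _ ≤ (ν.prod μ) {r | 1 / 2 ≤ μ (Prod.mk r ⁻¹' E)} := measure_mono hsub
    _ = 2 * (1 / 2 * (ν.prod μ) {r | 1 / 2 ≤ μ (Prod.mk r ⁻¹' E)}) := by
      rw [← mul_assoc, one_div, ENNReal.mul_inv_cancel two_ne_zero (by finiteness), one_mul]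
    _ ≤ 2 * ENNReal.ofReal q := by
      gcongr
      exact hmarkov.trans hint

end Swap

end BiasBounty

namespace BiasBounty

/-! ### Analysis of the main loop and of its failure probability. -/

section Loop

variable {X : Type u} {m : ℕ}

/-- The models of the main loop when it is run on the batches `B` and never stopped. -/
noncomputable def iterModel (opt : Optimizer X) (f : BinFun X) (B : ℕ → Dataset X m) : ℕ → BinFun X
  | 0 => f
  | t + 1 => listUpdate (iterModel opt f B t) (opt m (iterModel opt f B t) (B t))

/-- The model entering round t depends only on the earlier batches; the independence of the fresh
batch rests on this. -/
lemma iterModel_congr (opt : Optimizer X) (f : BinFun X) {B B' : ℕ → Dataset X m} {t : ℕ}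
    (h : ∀ s < t, B s = B' s) : iterModel opt f B t = iterModel opt f B' t := by
  induction t with
  | zero => rfl
  | succ t ih =>
    simp only [iterModel]
    rw [ih fun s hs => h s (hs.trans t.lt_succ_self), h t t.lt_succ_self]

lemma iterModel_shift (opt : Optimizer X) (f : BinFun X) (B : ℕ → Dataset X m) (t : ℕ) :
    iterModel opt (listUpdate f (opt m f (B 0))) (fun s => B (s + 1)) t =
      iterModel opt f B (t + 1) := by
  induction t with
  | zero => rfl
  | succ t ih =>
    rw [iterModel, ih]
    rfl

lemma trainLoop_calls_le (opt : Optimizer X) (ε : ℝ) (l : List (Dataset X m)) (f : BinFun X) :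
    (trainLoop opt ε l f).2 ≤ l.length := by
  induction l generalizing f with
  | nil => exact le_rfl
  | cons S l ih =>
    rw [trainLoop, List.length_cons]
    split_ifs
    · exact Nat.le_add_left _ _
    · exact Nat.succ_le_succ (ih _)

/-- The main loop outputs the model of the first round in which the optimizer finds no large
improvement, or the last model if there is no such round. -/
lemma exists_trainLoop_eq (opt : Optimizer X) (ε : ℝ) (l : List (Dataset X m)) (f : BinFun X)
    (B : ℕ → Dataset X m) (hB : ∀ s (h : s < l.length), l[s] = B s) :
    ∃ τ ≤ l.length, (trainLoop opt ε l f).1 = iterModel opt f B τ ∧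
      (∀ s < τ, 3 * ε / 4 < objective (B s) (iterModel opt f B s)
        (opt m (iterModel opt f B s) (B s))) ∧
      (τ < l.length → objective (B τ) (iterModel opt f B τ)
        (opt m (iterModel opt f B τ) (B τ)) ≤ 3 * ε / 4) := by
  induction l generalizing f B with
  | nil => exact ⟨0, le_rfl, rfl, by simp, by simp⟩
  | cons S l ih =>
    obtain rfl : S = B 0 := hB 0 (by simp)
    by_cases h : objective (B 0) f (opt m f (B 0)) ≤ 3 * ε / 4
    · refine ⟨0, Nat.zero_le _, ?_, by simp, fun _ => h⟩
      rw [trainLoop, if_pos h]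
      rfl
    · obtain ⟨τ, hτ, heq, hlt, hlast⟩ := ih (listUpdate f (opt m f (B 0))) (fun s => B (s + 1))
        fun s hs => hB (s + 1) (by simpa using hs)
      simp only [iterModel_shift] at heq hlt hlast
      refine ⟨τ + 1, by simpa using hτ, ?_, fun s hs => ?_, fun hτ' => hlast (by simpa using hτ')⟩
      · rw [trainLoop, if_neg h]
        exact heq
      · cases s with
        | zero => exact not_le.mp h
        | succ s => exact hlt s (Nat.lt_of_succ_lt_succ hs)

lemma trainByOpt_calls_le (opt : Optimizer X) {ε : ℝ} (hε : 0 < ε) (f : BinFun X) {n : ℕ}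
    (D : Dataset X n) (σ : Equiv.Perm (Fin n)) : ((trainByOpt opt ε f D σ).2 : ℝ) ≤ 2 / ε := by
  have h := trainLoop_calls_le opt ε
    (List.ofFn fun t : Fin (rounds ε) => batch (rounds ε) D σ t) f
  rw [List.length_ofFn] at h
  exact (Nat.cast_le.mpr h).trans (Nat.floor_le (by positivity))

/-- The block number `s`, of length `m`, of the sample `D`, padded by `z` if `D` is too short. -/
def block (z : X × Bool) (m : ℕ) {k : ℕ} (D : Dataset X k) (s : ℕ) : Dataset X m :=
  fun j => if h : s * m + j < k then D ⟨s * m + j, h⟩ else z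

lemma mul_add_lt_of_lt {t T m n : ℕ} (ht : t < T) (hn : T * m ≤ n) (j : Fin m) :
    t * m + j < n := by
  have h1 : (t + 1) * m ≤ T * m := Nat.mul_le_mul_right _ ht
  have h2 := j.isLt
  rw [add_mul, one_mul] at h1
  omega

lemma getElem_ofFn_batch (z : X × Bool) {T n : ℕ} (D : Dataset X n) (σ : Equiv.Perm (Fin n))
    (s : ℕ) (hs : s < (List.ofFn fun t => batch T D σ t).length) :
    (List.ofFn fun t => batch T D σ t)[s] = block z (n / T) (D ∘ σ) s := by
  rw [List.getElem_ofFn]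
  rw [List.length_ofFn] at hs
  funext j
  simp only [batch, block, dif_pos (mul_add_lt_of_lt hs (Nat.mul_div_le n T) j)]
  rfl

variable [MeasurableSpace X]

/-- Induction on t: the optimizer's measurability is applied to the previous model and composed with
D ↦ (D, B D t). -/
lemma measurable_iterModel {opt : Optimizer X} (hopt : IsMeasurableOptimizer opt) {f : BinFun X}
    (hf : Measurable f) {k : ℕ} {B : Dataset X k → ℕ → Dataset X m}
    (hB : ∀ t, Measurable fun D => B D t) (t : ℕ) :
    Measurable fun q : Dataset X k × X => iterModel opt f (B q.1) t q.2 := by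
  induction t with
  | zero => exact hf.comp measurable_snd
  | succ t ih =>
    obtain ⟨h1, h2⟩ := hopt k m (fun D => iterModel opt f (B D) t) ih
    have hq : Measurable fun q : Dataset X k × X => ((q.1, B q.1 t), q.2) :=
      (measurable_fst.prodMk ((hB t).comp measurable_fst)).prodMk measurable_snd
    exact Measurable.ite (measurableSet_eq_fun (h1.comp hq) measurable_const) (h2.comp hq) ih

/-- If the empirical gains of all rounds are within `ε / 4` of the expected ones, then the output
of the main loop is Bayes optimal. -/
lemma isBayesOptimal_trainLoop {P : Measure (X × Bool)} [IsProbabilityMeasure P]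
    {C : Set (BinFun X × BinFun X)} (hC : ∀ c ∈ C, Measurable c.1 ∧ Measurable c.2)
    {opt : Optimizer X} (hopt : IsExactOptimizer C opt) {ε : ℝ} {f : BinFun X}
    {l : List (Dataset X m)} {B : ℕ → Dataset X m} (hB : ∀ s (h : s < l.length), l[s] = B s)
    (hl : 2 / ε < l.length + 1) (hε : 0 < ε)
    (hm : ∀ t, Measurable (iterModel opt f B t))
    (hdev : ∀ t < l.length, ∀ c ∈ C, |objective (B t) (iterModel opt f B t) c -
      popGain P (iterModel opt f B t) c| ≤ ε / 4) :
    IsBayesOptimal P ε C (trainLoop opt ε l f).1 := by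
  obtain ⟨τ, hτ, heq, hlt, hlast⟩ := exists_trainLoop_eq opt ε l f B hB
  rw [heq]
  refine isBayesOptimal_of_popGain_le (hm τ) hC fun c hc => ?_
  rcases hτ.lt_or_eq with hτ' | hτ'
  · have h1 := (abs_le.mp (hdev τ hτ' c hc)).1
    have h2 := (hopt m (iterModel opt f B τ) (B τ)).2 c hc
    linarith [hlast hτ']
  -- No round stopped: each accepted empirical gain exceeds 3ε/4, so the expected one exceeds ε/2.
  · have hdec : ∀ s ≤ τ, popLoss P (iterModel opt f B s) ≤ 1 - s * (ε / 2) := by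
      intro s
      induction s with
      | zero => intro _; simpa using popLoss_le_one P _
      | succ s ih =>
        intro hs
        have h1 := ih (Nat.le_of_succ_le hs)
        have hmem := (hopt m (iterModel opt f B s) (B s)).1
        have h2 := (abs_le.mp (hdev s (by omega) _ hmem)).2
        have h3 := hlt s hs
        rw [iterModel, popLoss_listUpdate P (hm s) (hC _ hmem)]
        push_cast
        linarith
    have h1 := hdec τ le_rfl
    have h2 := popLoss_listUpdate P (hm τ) (hC c hc)
    have h3 := popLoss_nonneg P (listUpdate (iterModel opt f B τ) c)
    -- Since T + 1 > 2/ε, the remaining loss 1 - Tε/2 is below ε/2, and a gain cannot exceed the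
    -- remaining loss.
    rw [← hτ', div_lt_iff₀ hε] at hl
    linarith

lemma measurable_block (z : X × Bool) (m : ℕ) {k : ℕ} (s : ℕ) :
    Measurable fun D : Dataset X k => block z m D s := by
  refine measurable_pi_lambda _ fun j => ?_
  unfold block
  split_ifs
  · exact measurable_pi_apply _
  · exact measurable_const

/-- The probability that the empirical gains of a single round are inaccurate. -/
lemma measure_round_deviation_le {P : Measure (X × Bool)} [IsProbabilityMeasure P]
    {G H : Set (BinFun X)} {C : Set (BinFun X × BinFun X)} {dG dH : ℕ}
    (hG : vcDim G = dG) (hH : vcDim H = dH) (hC : C ⊆ G ×ˢ H)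
    (hCm : ∀ c ∈ C, Measurable c.1 ∧ Measurable c.2) (hCt : IsTraceMeasurable P C)
    {opt : Optimizer X} (hopt : IsMeasurableOptimizer opt) {f : BinFun X} (hf : Measurable f)
    (z : X × Bool) {n t T : ℕ} (ht : t < T) (hn : T * m ≤ n) (σ : Equiv.Perm (Fin n))
    {s : ℝ} (hs : 0 < s) (hm : 2 ≤ m * s ^ 2) :
    (Measure.pi fun _ => P) {D : Dataset X n | ∃ c ∈ C,
      2 * s < |objective (block z m (D ∘ σ) t) (iterModel opt f (block z m (D ∘ σ)) t) c -
        popGain P (iterModel opt f (block z m (D ∘ σ)) t) c|} ≤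
      2 * ENNReal.ofReal (2 * (2 * m + 1) ^ (dG + dH) * Real.exp (-(m * s ^ 2 / 8))) := by
  have htn : t * m ≤ n := (Nat.mul_le_mul_right _ ht.le).trans hn
  -- The indices of the first t blocks, which determine the model, and of block t are disjoint, so
  -- the two subsamples are independent.
  let e : Fin (t * m) → Fin n := fun i => σ (i.castLE htn)
  let e' : Fin m → Fin n := fun j => σ ⟨t * m + j, mul_add_lt_of_lt ht hn j⟩
  have he : Function.Injective (Sum.elim e e') := by
    rintro (i | i) (j | j) hij <;> have h := congrArg Fin.val (σ.injective hij) <;> simp at h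
    · rw [Fin.ext h]
    · exact absurd i.isLt (by omega)
    · exact absurd j.isLt (by omega)
    · rw [Fin.ext h]
  have hmp := measurePreserving_comp_prod P he
  refine le_trans (measure_mono ?_) ((hmp.measure_preimage_le _).trans
    (measure_exists_deviation_le hG hH hC hCm hCt (Measure.pi fun _ => P)
      (F := fun D' : Dataset X (t * m) => iterModel opt f (block z m D') t)
      (measurable_iterModel hopt hf (fun r => measurable_block z m r) t) hs hm))
  rintro D ⟨c, hc, hlt⟩
  refine ⟨c, hc, ?_⟩
  have h1 : iterModel opt f (block z m fun i => D (e i)) t =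
      iterModel opt f (block z m (D ∘ σ)) t := by
    refine iterModel_congr opt f fun r hr => funext fun j => ?_
    have hj : r * m + j < t * m := mul_add_lt_of_lt hr le_rfl j
    simp only [block, dif_pos hj, dif_pos (hj.trans_le htn)]
    rfl
  have h2 : block z m (D ∘ σ) t = fun j => D (e' j) := by
    funext j
    simp only [block, dif_pos (mul_add_lt_of_lt ht hn j)]
    rfl
  rw [h2] at hlt
  simpa only [h1] using hlt

/-- The failure probability of `trainByOpt` for a fixed division of the sample. -/
lemma measure_not_isBayesOptimal_le {P : Measure (X × Bool)} [IsProbabilityMeasure P]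
    {G H : Set (BinFun X)} {C : Set (BinFun X × BinFun X)} {dG dH : ℕ}
    (hG : vcDim G = dG) (hH : vcDim H = dH) (hC : C ⊆ G ×ˢ H)
    (hCm : ∀ c ∈ C, Measurable c.1 ∧ Measurable c.2) (hCt : IsTraceMeasurable P C)
    {opt : Optimizer X} (hex : IsExactOptimizer C opt) (hopt : IsMeasurableOptimizer opt)
    {f : BinFun X} (hf : Measurable f) {ε : ℝ} (hε : 0 < ε) {n : ℕ}
    (hm : 2 ≤ ((n / rounds ε : ℕ) : ℝ) * (ε / 8) ^ 2) (σ : Equiv.Perm (Fin n)) :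
    (Measure.pi fun _ => P)
        {D : Dataset X n | ¬ IsBayesOptimal P ε C (trainByOpt opt ε f D σ).1} ≤
      rounds ε * (2 * ENNReal.ofReal (2 * (2 * (n / rounds ε : ℕ) + 1) ^ (dG + dH) *
        Real.exp (-((n / rounds ε : ℕ) * (ε / 8) ^ 2 / 8)))) := by
  -- The padding value is never read in the first T blocks, as T * m ≤ n.
  obtain ⟨z⟩ : Nonempty (X × Bool) := nonempty_of_isProbabilityMeasure P
  set T := rounds ε
  set m := n / T
  have hn : T * m ≤ n := Nat.mul_div_le n T
  let bad : ℕ → Set (Dataset X n) := fun t => {D | ∃ c ∈ C,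
      2 * (ε / 8) < |objective (block z m (D ∘ σ) t) (iterModel opt f (block z m (D ∘ σ)) t) c -
        popGain P (iterModel opt f (block z m (D ∘ σ)) t) c|}
  have hsub : {D : Dataset X n | ¬ IsBayesOptimal P ε C (trainByOpt opt ε f D σ).1} ⊆
      ⋃ t ∈ Finset.range T, bad t := by
    intro D hD
    by_contra hnot
    simp only [Set.mem_iUnion, not_exists, Finset.mem_range] at hnot
    refine hD (isBayesOptimal_trainLoop hCm hex (B := block z m (D ∘ σ)) ?_ ?_ hε ?_ ?_)
    · exact getElem_ofFn_batch z D σ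
    · rw [List.length_ofFn]
      exact Nat.lt_floor_add_one _
    · intro t
      exact (measurable_iterModel hopt hf (fun r => measurable_block z m r) t).comp
        (measurable_prodMk_left (x := D ∘ σ))
    · intro t ht c hc
      rw [List.length_ofFn] at ht
      by_contra hlt
      exact hnot t ht ⟨c, hc, by linarith⟩
  calc _ ≤ _ := measure_mono hsub
    _ ≤ ∑ t ∈ Finset.range T, (Measure.pi fun _ => P) (bad t) := measure_biUnion_finset_le _ _
    _ ≤ _ := Finset.sum_le_card_nsmul _ _ _ fun t ht =>
      measure_round_deviation_le hG hH hC hCm hCt hopt hf z (Finset.mem_range.mp ht) hn σ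
        (by positivity) hm
    _ = _ := by rw [Finset.card_range, nsmul_eq_mul]

/-- A bound for each fixed division of the sample is a bound for the random division. -/
lemma runLaw_le {P : Measure (X × Bool)} [IsProbabilityMeasure P] {n : ℕ}
    {A : Set (Dataset X n × Equiv.Perm (Fin n))} {b : ENNReal}
    (h : ∀ σ, (Measure.pi fun _ => P) {D | (D, σ) ∈ A} ≤ b) : runLaw P n A ≤ b := by
  have : DiscreteMeasurableSpace (Equiv.Perm (Fin n)) := ⟨fun _ => trivial⟩
  have hA : A = ⋃ σ, {D | (D, σ) ∈ A} ×ˢ {σ} := by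
    ext ⟨D, σ⟩; simp
  have hu : IsProbabilityMeasure (uniformOn (Set.univ : Set (Equiv.Perm (Fin n)))) :=
    isProbabilityMeasure_uniformOn Set.finite_univ Set.univ_nonempty
  rw [hA]
  calc _ ≤ ∑ σ, runLaw P n ({D | (D, σ) ∈ A} ×ˢ {σ}) := measure_iUnion_fintype_le _ _
    _ = ∑ σ, (Measure.pi fun _ => P) {D | (D, σ) ∈ A} * uniformOn Set.univ {σ} :=
      Finset.sum_congr rfl fun σ _ => Measure.prod_prod _ _
    _ ≤ ∑ σ : Equiv.Perm (Fin n), b * uniformOn Set.univ {σ} := by gcongr with σ; exact h σ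
    _ = b := by
      rw [← Finset.mul_sum, sum_measure_singleton, Finset.coe_univ, measure_univ, mul_one]

end Loop

/-! ### The sample size suffices. -/

section Arithmetic

lemma sampleSize_bounds {ε δ : ℝ} {d n : ℕ} (hε : 0 < ε) (hε1 : ε < 1) (hδ : 0 < δ) (hδ1 : δ < 1)
    (hn : 200000 * ((d + Real.log (2 / δ)) / ε ^ 3) *
      Real.log (2 + (d + Real.log (2 / δ)) / ε ^ 3) ≤ n) :
    2 ≤ ((n / rounds ε : ℕ) : ℝ) * (ε / 8) ^ 2 ∧
    rounds ε * (2 * (2 * (2 * ((n / rounds ε : ℕ) : ℝ) + 1) ^ d *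
      Real.exp (-((n / rounds ε : ℕ) * (ε / 8) ^ 2 / 8)))) ≤ δ := by
  have hlog2 : (1 / 2 : ℝ) ≤ Real.log 2 := by linarith [Real.log_two_gt_d9]
  have hdelta : Real.log (2 / δ) = Real.log 2 - Real.log δ := Real.log_div two_ne_zero hδ.ne'
  have hlogδ : Real.log δ < 0 := Real.log_neg hδ hδ1
  set V := d + Real.log (2 / δ)
  set A := V / ε ^ 3 with hA
  set Lg := Real.log (2 + A) with hLg
  have hd0 : (0 : ℝ) ≤ d := d.cast_nonneg
  have hV1 : 1 / 2 ≤ V := by linarith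
  have hV0 : 0 < V := by linarith
  have hε3 : ε ^ 3 ≤ 1 := pow_le_one₀ hε.le hε1.le
  have hA0 : 0 < A := by positivity
  have hAε : A * ε ^ 3 = V := div_mul_cancel₀ _ (by positivity)
  have hL2 : Real.log 2 ≤ Lg := Real.log_le_log two_pos (by linarith)
  have hL1 : 1 / 2 ≤ Lg := by linarith
  have hV2 : V ≤ 2 * (V * Lg) := by nlinarith
  have hL2' : Lg ≤ 2 * (V * Lg) := by nlinarith
  have hVL : 1 / 4 ≤ V * Lg := by linarith
  set T := rounds ε
  set m := n / T
  have hTle : (T : ℝ) ≤ 2 / ε := Nat.floor_le (by positivity)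
  have hT1 : 1 ≤ T := Nat.le_floor (by rw [Nat.cast_one, le_div_iff₀ hε]; linarith)
  have hT0 : (0 : ℝ) < T := by exact_mod_cast hT1
  have hnm : (n : ℝ) < (m + 1) * T := by
    have := Nat.lt_div_mul_add (a := n) (b := T) hT1
    have h2 : n < (m + 1) * T := by rw [add_mul, one_mul]; exact this
    exact_mod_cast h2
  -- Two powers of 1/ε come from the accuracy and one from sharing the sample among about 2/ε
  -- batches. The m + 1 accounts for the floor in n / T.
  have hmε : 100000 * (V * Lg) ≤ (m + 1) * ε ^ 2 := by
    have h1 : (n : ℝ) ≤ (m + 1) * (2 / ε) := hnm.le.trans (by gcongr)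
    have h2 : 200000 * A * Lg * ε ^ 3 ≤ (m + 1) * (2 / ε) * ε ^ 3 := by
      exact mul_le_mul_of_nonneg_right (hn.trans h1) (by positivity)
    have h3 : (m + 1) * (2 / ε) * ε ^ 3 = 2 * ((m + 1) * ε ^ 2) := by field_simp
    have h4 : 200000 * A * Lg * ε ^ 3 = 200000 * (V * Lg) := by rw [← hAε]; ring
    linarith
  have hε2 : ε ^ 2 ≤ 1 := pow_le_one₀ hε.le hε1.le
  have hmε' : 50000 * (V * Lg) ≤ m * ε ^ 2 := by
    have := add_one_mul (m : ℝ) (ε ^ 2)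
    linarith
  have hm1 : (1 : ℝ) ≤ m := by
    have := mul_le_of_le_one_right (Nat.cast_nonneg m : (0 : ℝ) ≤ m) hε2
    linarith
  refine ⟨by rw [div_pow]; linarith, ?_⟩
  -- The inequality log x ≤ x/B - 1 + log B removes m from inside the logarithm. With B = 4096 V/ε²,
  -- the linear term times d is at most m ε²/1024, half of the exponent m ε²/512.
  have hlogB : Real.log (2 * m + 1) ≤ 13 * Lg + (2 * m + 1) / (4096 * V / ε ^ 2) := by
    set B := 4096 * V / ε ^ 2 with hB
    have hB0 : 0 < B := by positivity
    have h1 : Real.log (2 * m + 1) = Real.log ((2 * m + 1) / B) + Real.log B := by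
      rw [Real.log_div (by positivity) hB0.ne']; ring
    have h2 : Real.log ((2 * m + 1) / B) ≤ (2 * m + 1) / B - 1 :=
      Real.log_le_sub_one_of_pos (by positivity)
    have h3 : B ≤ 2 ^ 12 * (2 + A) := by
      have : V / ε ^ 2 ≤ A := by
        rw [hA]
        exact div_le_div_of_nonneg_left hV0.le (by positivity)
          (pow_le_pow_of_le_one hε.le hε1.le (by norm_num))
      have h5 : B = 4096 * (V / ε ^ 2) := by rw [hB]; ring
      rw [h5]
      linarith
    have h4 : Real.log B ≤ 12 * Real.log 2 + Lg := by
      refine (Real.log_le_log hB0 h3).trans_eq ?_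
      rw [Real.log_mul (by positivity) (by positivity), Real.log_pow]
      norm_num [hLg]
    linarith
  have hdlog : d * Real.log (2 * m + 1) ≤ 13 * (V * Lg) + m * ε ^ 2 / 1024 := by
    have h0 : 0 ≤ Real.log (2 * m + 1) := Real.log_nonneg (by linarith)
    have h1 : V * ((2 * m + 1) / (4096 * V / ε ^ 2)) = (2 * m + 1) * ε ^ 2 / 4096 := by
      field_simp
    calc d * Real.log (2 * m + 1) ≤ V * Real.log (2 * m + 1) := by gcongr; linarith
      _ ≤ V * (13 * Lg + (2 * m + 1) / (4096 * V / ε ^ 2)) := by gcongr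
      _ = 13 * (V * Lg) + (2 * m + 1) * ε ^ 2 / 4096 := by rw [mul_add, h1]; ring
      _ ≤ _ := by
        have := mul_le_mul_of_nonneg_right hm1 (sq_nonneg ε)
        linarith
  have hlogT : Real.log (4 * T) ≤ 10 * (V * Lg) := by
    have h1 : 4 * T ≤ 2 ^ 4 * (2 + A) := by
      have h2 : 1 / ε ≤ 2 * A := by
        rw [hA, ← mul_div_assoc, div_le_div_iff₀ hε (by positivity)]
        have h3 : ε ^ 3 ≤ ε := pow_le_of_le_one hε.le hε1.le three_ne_zero
        have h4 : 1 * ε ≤ 2 * V * ε := by gcongr; linarith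
        linarith
      have h3 : (2 : ℝ) / ε = 2 * (1 / ε) := by ring
      linarith
    have h2 : Real.log (4 * T) ≤ 4 * Real.log 2 + Lg := by
      refine (Real.log_le_log (by positivity) h1).trans_eq ?_
      rw [Real.log_mul (by positivity) (by positivity), Real.log_pow]
      norm_num [hLg]
    linarith
  have hlogd : -Real.log δ ≤ 2 * (V * Lg) := by linarith
  -- The factor 4T combines the number of rounds, the 2 from Markov and the 2 from the two-sided
  -- tail.
  have hexp : T * (2 * (2 * (2 * (m : ℝ) + 1) ^ d * Real.exp (-(m * (ε / 8) ^ 2 / 8)))) =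
      Real.exp (Real.log (4 * T) + d * Real.log (2 * m + 1) - m * ε ^ 2 / 512) := by
    rw [sub_eq_add_neg, Real.exp_add, Real.exp_add, Real.exp_log (by positivity),
      Real.exp_nat_mul, Real.exp_log (by positivity),
      show m * (ε / 8) ^ 2 / 8 = m * ε ^ 2 / 512 by ring]
    ring
  rw [hexp, ← Real.le_log_iff_exp_le hδ]
  linarith

end Arithmetic

end BiasBounty

/-! ### Assembly. -/

theorem mainTheorem4 :
    ∃ K : ℝ, 0 < K ∧ ∃ q : ℕ,
      ∀ (X : Type u) [MeasurableSpace X] (P : Measure (X × Bool)) [IsProbabilityMeasure P]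
        (G H : Set (BiasBounty.BinFun X)) (dG dH : ℕ)
        (C : Set (BiasBounty.BinFun X × BiasBounty.BinFun X))
        (opt : BiasBounty.Optimizer X) (f₀ : BiasBounty.BinFun X) (ε δ : ℝ) (n : ℕ),
        BiasBounty.vcDim G = dG →
        BiasBounty.vcDim H = dH →
        C ⊆ G ×ˢ H →
        (∀ c ∈ C, Measurable c.1 ∧ Measurable c.2) →
        BiasBounty.IsTraceMeasurable P C →
        BiasBounty.IsExactOptimizer C opt →
        BiasBounty.IsMeasurableOptimizer opt →
        Measurable f₀ →
        0 < ε →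
        0 < δ →
        δ < 1 →
        K * ((dG + dH + Real.log (2 / δ)) / ε ^ 3) *
            Real.log (2 + (dG + dH + Real.log (2 / δ)) / ε ^ 3) ^ q ≤ n →
        (∀ (D : BiasBounty.Dataset X n) (σ : Equiv.Perm (Fin n)),
          ((BiasBounty.trainByOpt opt ε f₀ D σ).2 : ℝ) ≤ 2 / ε) ∧
        BiasBounty.runLaw P n
            {r | ¬ BiasBounty.IsBayesOptimal P ε C (BiasBounty.trainByOpt opt ε f₀ r.1 r.2).1}
          ≤ ENNReal.ofReal δ := by
  refine ⟨200000, by norm_num, 1, ?_⟩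
  intro X _ P _ G H dG dH C opt f₀ ε δ n hG hH hC hCm hCt hex hopt hf hε hδ hδ1 hn
  refine ⟨BiasBounty.trainByOpt_calls_le opt hε f₀, BiasBounty.runLaw_le fun σ => ?_⟩
  -- For ε ≥ 1 every measurable model is optimal, so no sampling estimate is needed; this also
  -- covers ε > 2, where there are no rounds.
  rcases le_or_gt 1 ε with hε1 | hε1
  · obtain ⟨z⟩ : Nonempty (X × Bool) := nonempty_of_isProbabilityMeasure P
    have hempty : {D : BiasBounty.Dataset X n | ¬ BiasBounty.IsBayesOptimal P ε C
        (BiasBounty.trainByOpt opt ε f₀ D σ).1} = ∅ := by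
      refine Set.eq_empty_of_forall_notMem fun D hD => hD ?_
      let B := BiasBounty.block z (n / BiasBounty.rounds ε) (D ∘ σ)
      obtain ⟨τ, -, heq, -⟩ := BiasBounty.exists_trainLoop_eq opt ε
        (List.ofFn fun t => BiasBounty.batch (BiasBounty.rounds ε) D σ t) f₀ B
        (BiasBounty.getElem_ofFn_batch z D σ)
      rw [BiasBounty.trainByOpt, heq]
      exact BiasBounty.isBayesOptimal_of_one_le P hε1
        ((BiasBounty.measurable_iterModel hopt hf
          (fun r => BiasBounty.measurable_block z _ r) τ).comp
            (measurable_prodMk_left (x := D ∘ σ))) hCm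
    exact (measure_mono_null hempty.le measure_empty).trans_le bot_le
  · rw [pow_one, ← Nat.cast_add] at hn
    obtain ⟨h1, h2⟩ := BiasBounty.sampleSize_bounds hε hε1 hδ hδ1 hn
    refine (BiasBounty.measure_not_isBayesOptimal_le hG hH hC hCm hCt hex hopt hf hε h1 σ).trans ?_
    rw [← ENNReal.ofReal_natCast, ← ENNReal.ofReal_ofNat 2,
      ← ENNReal.ofReal_mul (by positivity), ← ENNReal.ofReal_mul (by positivity)]
    exact ENNReal.ofReal_le_ofReal h2
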